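/- Let $\ell\ge 1$ be an integer and let $0<p<q$ with $q=1-p$. For $-\ell\le n\le\ell$ put $p_n=\binom{2\ell}{\ell+n}p^{\ell+n}q^{\ell-n}$, and put $p_n=0$ for all other integers $n$. Let $p(z)=\sum_{-\ell\le i\le\ell}p_iz^i$ and $\omega_\ell=\cos(2\pi/\ell)+\mathbf{i}\sin(2\pi/\ell)$. For $k\in\{-1,0,1\}$ let $A_k$ be the $\ell\times\ell$ matrix with entries $(A_k)_{ij}=p_{k\ell+j-i}$, $1\le i,j\le\ell$. There are a unique (row-)stochastic matrix $G$ with $A_{-1}+(A_0-I)G+A_1G^2=0$, and a unique entrywise non-negative matrix $R$ with all eigenvalues in the open unit disk such that $R^2A_{-1}+R(A_0-I)+A_1=0$. Moreover: 1. The polynomial $h(z)=z^\ell-z^\ell p(z)$ equals $z^\ell-(q+pz)^{2\ell}$, and its roots are, counted with multiplicity, the roots of the $\ell$ quadratic polynomials $s_j(z)=(pz+q)^2-\omega_\ell^{\,j-1}z$, $1\le j\le\ell$. 2. Denote by $\sigma_j$ and $\mu_j$ the two complex roots of $s_j$ (with multiplicity), labelled so that $|\sigma_j|\le|\mu_j|$.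 Then $|\sigma_j|\le 1<|\mu_j|$ for $1\le j\le\ell$; in particular $\sigma_1=1$ and $\mu_1=(q/p)^2$. 3. The eigenvalues of $G$ are $\{\sigma_j^\ell:1\le j\le\ell\}$ and the eigenvalues of $R$ are $\{\mu_j^{-\ell}:1\le j\le\ell\}$, both as sets and counted with algebraic multiplicity. -/

import Mathlib

namespace TrafficQBD

open Polynomial LaurentPolynomial

noncomputable section

/-- The probability `p_n = (2ℓ choose ℓ+n) p^(ℓ+n) q^(ℓ-n)`, `-ℓ ≤ n ≤ ℓ`, that the line changes by
`n` cars during one cycle of length `2ℓ`; it is `0` for all other `n`. -/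
def jumpProb (ℓ : ℕ) (p q : ℝ) (n : ℤ) : ℝ :=
  if -(ℓ : ℤ) ≤ n ∧ n ≤ ℓ then
    ((2 * ℓ).choose ((ℓ : ℤ) + n).toNat : ℝ) * p ^ ((ℓ : ℤ) + n).toNat * q ^ ((ℓ : ℤ) - n).toNat
  else 0

/-- The `ℓ × ℓ` block `A_k` (`k = -1, 0, 1`) of the transition matrix, with entries
`(A_k)_{ij} = p_{kℓ + j - i}`. -/
def block (ℓ : ℕ) (p q : ℝ) (k : ℤ) : Matrix (Fin ℓ) (Fin ℓ) ℝ :=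
  Matrix.of fun i j => jumpProb ℓ p q (k * ℓ + (j : ℤ) - (i : ℤ))

/-- The Laurent polynomial `p(z) = ∑_{-ℓ ≤ i ≤ ℓ} p_i z^i`. -/
def jumpGen (ℓ : ℕ) (p q : ℝ) : LaurentPolynomial ℂ :=
  ∑ i ∈ Finset.Icc (-(ℓ : ℤ)) ℓ, LaurentPolynomial.C (jumpProb ℓ p q i : ℂ) * T i

/-- The polynomial `h(z) = z^ℓ - z^ℓ p(z)`. -/
def hPoly (ℓ : ℕ) (p q : ℝ) : ℂ[X] :=
  X ^ ℓ - ∑ i ∈ Finset.Icc (-(ℓ : ℤ)) ℓ,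
    Polynomial.C (jumpProb ℓ p q i : ℂ) * X ^ ((ℓ : ℤ) + i).toNat

/-- `hPoly` is indeed `z^ℓ - z^ℓ p(z)`, as an identity of Laurent polynomials. -/
theorem toLaurent_hPoly (ℓ : ℕ) (p q : ℝ) :
    toLaurent (hPoly ℓ p q) = T (ℓ : ℤ) - T (ℓ : ℤ) * jumpGen ℓ p q := by
  unfold hPoly jumpGen
  rw [map_sub, Polynomial.toLaurent_X_pow, map_sum, Finset.mul_sum]
  congr 1
  refine Finset.sum_congr rfl fun i hi => ?_
  rw [Finset.mem_Icc] at hi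
  rw [Polynomial.toLaurent_C_mul_X_pow, Int.toNat_of_nonneg (by omega), T_add]
  ring

/-- The primitive root of unity `ω_ℓ = cos(2π/ℓ) + i sin(2π/ℓ)`. -/
def omega (ℓ : ℕ) : ℂ :=
  (Real.cos (2 * Real.pi / ℓ) : ℂ) + Complex.I * (Real.sin (2 * Real.pi / ℓ) : ℂ)

/-- The quadratic `s_j(z) = (p z + q)^2 - ω_ℓ^(j-1) z`, used for `1 ≤ j ≤ ℓ`. -/
def sPoly (ℓ : ℕ) (p q : ℝ) (j : ℕ) : ℂ[X] :=
  (Polynomial.C (p : ℂ) * X + Polynomial.C (q : ℂ)) ^ 2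
    - Polynomial.C (omega ℓ ^ (j - 1)) * X

/-- `σ j` and `μ j` are the two roots of `s_j`, counted with multiplicity and ordered by modulus,
for `1 ≤ j ≤ ℓ`. -/
def IsRootLabelling (ℓ : ℕ) (p q : ℝ) (σ μ : ℕ → ℂ) : Prop :=
  ∀ j ∈ Finset.Icc 1 ℓ, (sPoly ℓ p q j).roots = {σ j, μ j} ∧ ‖σ j‖ ≤ ‖μ j‖

/-- The set of complex eigenvalues of a real square matrix. -/
def eigenvalues {ℓ : ℕ} (M : Matrix (Fin ℓ) (Fin ℓ) ℝ) : Set ℂ :=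
  {z | Module.End.HasEigenvalue (Matrix.toLin' (M.map Complex.ofReal)) z}

/-- The complex eigenvalues of a real square matrix, with their algebraic multiplicities. -/
def eigenvalueMultiset {ℓ : ℕ} (M : Matrix (Fin ℓ) (Fin ℓ) ℝ) : Multiset ℂ :=
  (M.map Complex.ofReal).charpoly.roots

/-- `G` is a (row-)stochastic solution of `A_{-1} + (A_0 - I) G + A_1 G^2 = 0`. -/
structure IsG (ℓ : ℕ) (p q : ℝ) (G : Matrix (Fin ℓ) (Fin ℓ) ℝ) : Prop where
  stochastic : G ∈ Matrix.rowStochastic ℝ (Fin ℓ)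
  equation : block ℓ p q (-1) + (block ℓ p q 0 - 1) * G + block ℓ p q 1 * G ^ 2 = 0

/-- `R` is a non-negative solution of `R^2 A_{-1} + R (A_0 - I) + A_1 = 0` with all its eigenvalues
in the open unit disk. -/
structure IsR (ℓ : ℕ) (p q : ℝ) (R : Matrix (Fin ℓ) (Fin ℓ) ℝ) : Prop where
  nonneg : ∀ i j, 0 ≤ R i j
  eigenvalues_lt : ∀ z ∈ eigenvalues R, ‖z‖ < 1
  equation : R ^ 2 * block ℓ p q (-1) + R * (block ℓ p q 0 - 1) + block ℓ p q 1 = 0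

end

end TrafficQBD

/-! For a complex solution `G`, the linear map `rowMap G : ℂ[X] → ℂ^ℓ`, `X ^ (ℓ * k + i) ↦` row `i`
of `G ^ k`, turns multiplication by `X ^ ℓ` into right multiplication by `G`. The matrix equation
then says that `h` and all its multiples are killed (`hPoly_mem_rowIdeal`); by Cayley–Hamilton so is
`χ_G(X ^ ℓ)`. If `h = S * M` and no root of `M` has its `ℓ`-th power in the spectrum of `G`, Bézout
leaves `S` in the ideal (`factor_mem_rowIdeal`). When `S` is monic of degree `ℓ`, `rowMap G` is
reduction modulo `S`. Hence `S` determines `G`, which gives uniqueness, and `G` is the `ℓ`-th power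
of the companion matrix of `S`, which gives the eigenvalues with multiplicity
(`roots_charpoly_of_mem_rowIdeal`).

For `G` take `S = ∏ (X - σ_j)`: the eigenvalues of a stochastic matrix lie in the closed disk, the
`μ_j` outside it. For `R`, transposition exchanges `p` and `q` and inverts the roots, so the same
argument applies to the transpose with `S = ∏ (X - μ_j⁻¹)`. Existence comes from monotone iteration,
bounded by a geometric vector (`exists_nonneg_solution`). -/

namespace TrafficQBD

open Polynomial

/-! ### The polynomial `h` and its quadratic factors -/

theorem jumpProb_eq_coeff (ℓ : ℕ) (P Q : ℝ) (n : ℤ) (m : ℕ) (h : n + ℓ = m) :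
    (jumpProb ℓ P Q n : ℂ) = ((C (Q : ℂ) + C (P : ℂ) * X) ^ (2 * ℓ)).coeff m := by
  have key : ((C (Q : ℂ) + C (P : ℂ) * X) ^ (2 * ℓ)).coeff m
      = (2 * ℓ).choose m * (P : ℂ) ^ m * (Q : ℂ) ^ (2 * ℓ - m) := by
    rw [add_comm, add_pow, finsetSum_coeff]
    have : ∀ b ∈ Finset.range (2 * ℓ + 1),
        ((C (P : ℂ) * X) ^ b * C (Q : ℂ) ^ (2 * ℓ - b) * ((2 * ℓ).choose b : ℂ[X])).coeff m
          = if m = b then (2 * ℓ).choose m * (P : ℂ) ^ m * (Q : ℂ) ^ (2 * ℓ - m) else 0 := by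
      intro b _
      have : (C (P : ℂ) * X) ^ b * C (Q : ℂ) ^ (2 * ℓ - b) * ((2 * ℓ).choose b : ℂ[X])
          = C ((2 * ℓ).choose b * (P : ℂ) ^ b * (Q : ℂ) ^ (2 * ℓ - b)) * X ^ b := by
        simp only [C_mul, C_pow, map_natCast]
        ring
      rw [this, coeff_C_mul_X_pow]
      split_ifs with hb
      · rw [hb]
      · rfl
    rw [Finset.sum_congr rfl this, Finset.sum_ite_eq]
    split_ifs with hm
    · rfl
    · rw [Finset.mem_range, not_lt] at hm
      rw [Nat.choose_eq_zero_of_lt (by omega)]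
      simp
  rw [key, jumpProb]
  split_ifs with hn
  · have h1 : ((ℓ : ℤ) + n).toNat = m := by omega
    have h2 : ((ℓ : ℤ) - n).toNat = 2 * ℓ - m := by omega
    rw [h1, h2]
    push_cast
    rfl
  -- As `n + ℓ = m ≥ 0`, leaving the range can only mean `m > 2ℓ`.
  · rw [Nat.choose_eq_zero_of_lt (by omega)]
    simp

theorem natDegree_linear_pow_le (ℓ : ℕ) (P Q : ℂ) :
    ((C Q + C P * X) ^ (2 * ℓ)).natDegree ≤ 2 * ℓ := by
  refine (natDegree_pow_le).trans ?_
  have : (C Q + C P * X).natDegree ≤ 1 := by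
    rw [add_comm]; exact natDegree_linear_le
  nlinarith

theorem hPoly_eq (ℓ : ℕ) (P Q : ℝ) :
    hPoly ℓ P Q = X ^ ℓ - (C (Q : ℂ) + C (P : ℂ) * X) ^ (2 * ℓ) := by
  unfold hPoly
  congr 1
  rw [as_sum_range' ((C (Q : ℂ) + C (P : ℂ) * X) ^ (2 * ℓ)) (2 * ℓ + 1)
    (Nat.lt_succ_of_le (natDegree_linear_pow_le ℓ P Q))]
  refine Finset.sum_bij' (fun i _ => ((ℓ : ℤ) + i).toNat) (fun m _ => (m : ℤ) - ℓ) ?_ ?_ ?_ ?_ ?_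
  · intro i hi
    rw [Finset.mem_Icc] at hi
    rw [Finset.mem_range]
    omega
  · intro m hm
    rw [Finset.mem_range] at hm
    rw [Finset.mem_Icc]
    omega
  · intro i hi
    rw [Finset.mem_Icc] at hi
    omega
  · intro m _
    omega
  · intro i hi
    rw [Finset.mem_Icc] at hi
    rw [jumpProb_eq_coeff ℓ P Q i (((ℓ : ℤ) + i).toNat) (by omega), C_mul_X_pow_eq_monomial]

theorem omega_isPrimitiveRoot (ℓ : ℕ) (hℓ : 1 ≤ ℓ) : IsPrimitiveRoot (omega ℓ) ℓ := by
  have : omega ℓ = Complex.exp (2 * Real.pi * Complex.I / ℓ) := by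
    have h : (2 * Real.pi * Complex.I / ℓ : ℂ) = ((2 * Real.pi / ℓ : ℝ) : ℂ) * Complex.I := by
      push_cast
      ring
    rw [h, Complex.exp_mul_I, omega]
    push_cast
    ring
  rw [this]
  exact Complex.isPrimitiveRoot_exp ℓ (by omega)

theorem norm_omega_pow (ℓ : ℕ) (hℓ : 1 ≤ ℓ) (k : ℕ) : ‖omega ℓ ^ k‖ = 1 := by
  rw [norm_pow, (omega_isPrimitiveRoot ℓ hℓ).norm'_eq_one (by omega), one_pow]

/-- This is `x^ℓ - y^ℓ = ∏ (x - ζ y)` over the `ℓ`-th roots of unity in `ℂ[X]`, with `x = (Q + P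
X)^2` and `y = X`. -/
theorem hPoly_eq_neg_prod (ℓ : ℕ) (hℓ : 1 ≤ ℓ) (P Q : ℝ) :
    hPoly ℓ P Q = -∏ j ∈ Finset.Icc 1 ℓ, sPoly ℓ P Q j := by
  have hprim := omega_isPrimitiveRoot ℓ hℓ
  have hC : IsPrimitiveRoot (C (omega ℓ)) ℓ := hprim.map_of_injective (f := C) C_injective
  have hprod := hC.pow_sub_pow_eq_prod_sub_mul
    (x := (C (Q : ℂ) + C (P : ℂ) * X) ^ 2) (y := X) (by omega)
  rw [hPoly_eq, pow_mul, ← neg_sub, hprod]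
  congr 1
  symm
  refine Finset.prod_bij (fun j _ => C (omega ℓ) ^ (j - 1)) ?_ ?_ ?_ ?_
  · intro j _
    rw [mem_nthRootsFinset (by omega), ← pow_mul, mul_comm, pow_mul, hC.pow_eq_one, one_pow]
  · intro a ha b hb hab
    rw [Finset.mem_Icc] at ha hb
    have := hC.pow_inj (by omega) (by omega) hab
    omega
  · intro ζ hζ
    rw [mem_nthRootsFinset (by omega)] at hζ
    have : NeZero ℓ := ⟨by omega⟩
    obtain ⟨i, hi, rfl⟩ := hC.eq_pow_of_pow_eq_one hζ
    exact ⟨i + 1, Finset.mem_Icc.2 (by omega), rfl⟩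
  · intro j _
    rw [sPoly, C_pow]
    ring

theorem sPoly_eq (ℓ : ℕ) (P Q : ℝ) (j : ℕ) :
    sPoly ℓ P Q j = C ((P : ℂ) ^ 2) * X ^ 2 + C (2 * P * Q - omega ℓ ^ (j - 1)) * X
      + C ((Q : ℂ) ^ 2) := by
  rw [sPoly]
  simp only [C_sub, C_mul, C_pow, map_ofNat]
  ring

theorem natDegree_sPoly (ℓ : ℕ) {P : ℝ} (hP : P ≠ 0) (Q : ℝ) (j : ℕ) :
    (sPoly ℓ P Q j).natDegree = 2 := by
  rw [sPoly_eq]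
  exact natDegree_quadratic (by simpa using hP)

theorem sPoly_ne_zero (ℓ : ℕ) {P : ℝ} (hP : P ≠ 0) (Q : ℝ) (j : ℕ) : sPoly ℓ P Q j ≠ 0 := by
  intro h
  have := natDegree_sPoly ℓ hP Q j
  simp [h] at this

theorem leadingCoeff_sPoly (ℓ : ℕ) {P : ℝ} (hP : P ≠ 0) (Q : ℝ) (j : ℕ) :
    (sPoly ℓ P Q j).leadingCoeff = (P : ℂ) ^ 2 := by
  rw [sPoly_eq]
  exact leadingCoeff_quadratic (by simpa using hP)

theorem prod_sPoly_ne_zero (ℓ : ℕ) {P : ℝ} (hP : P ≠ 0) (Q : ℝ) :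
    ∏ j ∈ Finset.Icc 1 ℓ, sPoly ℓ P Q j ≠ 0 :=
  Finset.prod_ne_zero_iff.2 fun j _ => sPoly_ne_zero ℓ hP Q j

theorem roots_hPoly (ℓ : ℕ) (hℓ : 1 ≤ ℓ) {P : ℝ} (hP : P ≠ 0) (Q : ℝ) :
    (hPoly ℓ P Q).roots = ∑ j ∈ Finset.Icc 1 ℓ, (sPoly ℓ P Q j).roots := by
  rw [hPoly_eq_neg_prod ℓ hℓ, roots_neg, roots_prod _ _ (prod_sPoly_ne_zero ℓ hP Q)]
  rfl

theorem isRoot_hPoly_iff (ℓ : ℕ) (hℓ : 1 ≤ ℓ) (P Q : ℝ) (z : ℂ) :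
    (hPoly ℓ P Q).IsRoot z ↔ ∃ j ∈ Finset.Icc 1 ℓ, (sPoly ℓ P Q j).IsRoot z := by
  simp only [hPoly_eq_neg_prod ℓ hℓ, IsRoot.def, eval_neg, neg_eq_zero, eval_prod,
    Finset.prod_eq_zero_iff]

theorem exists_isRootLabelling (ℓ : ℕ) {P : ℝ} (hP : P ≠ 0) (Q : ℝ) :
    ∃ σ μ : ℕ → ℂ, IsRootLabelling ℓ P Q σ μ := by
  have key : ∀ j, ∃ x : ℂ × ℂ, (sPoly ℓ P Q j).roots = {x.1, x.2} ∧ ‖x.1‖ ≤ ‖x.2‖ := by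
    intro j
    have hc : (sPoly ℓ P Q j).roots.card = 2 := by
      rw [← (IsAlgClosed.splits (sPoly ℓ P Q j)).natDegree_eq_card_roots, natDegree_sPoly ℓ hP]
    obtain ⟨x, y, hxy⟩ := Multiset.card_eq_two.1 hc
    rcases le_total ‖x‖ ‖y‖ with h | h
    · exact ⟨(x, y), hxy, h⟩
    · exact ⟨(y, x), by rw [hxy]; exact Multiset.pair_comm x y, h⟩
  choose f hf using key
  exact ⟨fun j => (f j).1, fun j => (f j).2, fun j _ => hf j⟩

theorem sPoly_eq_of_roots {ℓ : ℕ} {P : ℝ} (hP : P ≠ 0) {Q : ℝ} {j : ℕ} {a b : ℂ}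
    (h : (sPoly ℓ P Q j).roots = {a, b}) :
    sPoly ℓ P Q j = C ((P : ℂ) ^ 2) * ((X - C a) * (X - C b)) := by
  have := (IsAlgClosed.splits (sPoly ℓ P Q j)).eq_prod_roots
  rw [h, leadingCoeff_sPoly ℓ hP] at this
  simpa using this

theorem roots_relations {ℓ : ℕ} {P : ℝ} (hP : P ≠ 0) {Q : ℝ} {j : ℕ} {a b : ℂ}
    (h : (sPoly ℓ P Q j).roots = {a, b}) :
    (P : ℂ) ^ 2 * (a * b) = (Q : ℂ) ^ 2 ∧
      (P : ℂ) ^ 2 * (a + b) = omega ℓ ^ (j - 1) - 2 * P * Q := by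
  have h1 := sPoly_eq_of_roots hP h
  rw [sPoly_eq] at h1
  have e0 := congrArg (eval 0) h1
  have e1 := congrArg (eval 1) h1
  simp only [eval_add, eval_mul, eval_C, eval_X, eval_pow, eval_sub] at e0 e1
  refine ⟨by linear_combination -e0, by linear_combination e1 - e0⟩

theorem isRoot_of_roots {ℓ : ℕ} {P : ℝ} {Q : ℝ} {j : ℕ} {a b : ℂ}
    (h : (sPoly ℓ P Q j).roots = {a, b}) :
    (P * a + Q) ^ 2 = omega ℓ ^ (j - 1) * a ∧ (P * b + Q) ^ 2 = omega ℓ ^ (j - 1) * b := by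
  have ha : a ∈ (sPoly ℓ P Q j).roots := by rw [h]; simp
  have hb : b ∈ (sPoly ℓ P Q j).roots := by rw [h]; simp
  have ha' := isRoot_of_mem_roots ha
  have hb' := isRoot_of_mem_roots hb
  simp only [sPoly, IsRoot.def, eval_sub, eval_pow, eval_add, eval_mul, eval_C, eval_X] at ha' hb'
  exact ⟨sub_eq_zero.1 ha', sub_eq_zero.1 hb'⟩

/-! ### Location of the roots -/

/-- A root of `(P z + Q) ^ 2 = w z` with `‖w‖ = 1` outside the closed unit disk has modulus at
least `(Q / P) ^ 2`. -/
theorem norm_root_large {P Q : ℝ} (hP : 0 < P) (hQ : 0 < Q) (hPQ : P + Q = 1) {w z : ℂ}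
    (hw : ‖w‖ = 1) (hz : (P * z + Q) ^ 2 = w * z) (h1 : 1 < ‖z‖) : Q ^ 2 ≤ P ^ 2 * ‖z‖ := by
  have hn : ‖(P * z + Q : ℂ)‖ ^ 2 = ‖z‖ := by
    rw [← norm_pow, hz, norm_mul, hw, one_mul]
  have hle : ‖(P * z + Q : ℂ)‖ ≤ P * ‖z‖ + Q := by
    refine (norm_add_le _ _).trans (le_of_eq ?_)
    rw [norm_mul, Complex.norm_of_nonneg hP.le, Complex.norm_of_nonneg hQ.le]
  have hsq : ‖z‖ ≤ (P * ‖z‖ + Q) ^ 2 := by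
    calc ‖z‖ = ‖(P * z + Q : ℂ)‖ ^ 2 := hn.symm
      _ ≤ _ := pow_le_pow_left₀ (norm_nonneg _) hle 2
  have hQ' : Q = 1 - P := by linarith
  -- Since `P + Q = 1`, the product is exactly `(P‖z‖ + Q)^2 - ‖z‖`.
  have : 0 ≤ (P ^ 2 * ‖z‖ - Q ^ 2) * (‖z‖ - 1) := by
    subst hQ'
    nlinarith
  have := nonneg_of_mul_nonneg_left this (by linarith)
  linarith

/-- The moduli multiply to `(Q / P)^2 > 1`, so the larger root is outside the unit disk. It then
already has modulus at least `(Q / P)^2` by `norm_root_large`, which leaves at most `1` for the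
other. -/
theorem norm_roots {ℓ : ℕ} (hℓ : 1 ≤ ℓ) {P Q : ℝ} (hP : 0 < P) (hPQ : P + Q = 1) (hlt : P < Q)
    {j : ℕ} {a b : ℂ} (h : (sPoly ℓ P Q j).roots = {a, b}) (hab : ‖a‖ ≤ ‖b‖) :
    ‖a‖ ≤ 1 ∧ 1 < ‖b‖ := by
  have hQ : 0 < Q := hP.trans hlt
  have hprod : P ^ 2 * (‖a‖ * ‖b‖) = Q ^ 2 := by
    have := congrArg norm (roots_relations hP.ne' h).1
    simpa [abs_of_pos hP, abs_of_pos hQ] using this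
  have hPQ2 : P ^ 2 < Q ^ 2 := by gcongr
  have hP2 : 0 < P ^ 2 := by positivity
  have hb : 1 < ‖b‖ := by
    by_contra hb
    push Not at hb
    have : ‖a‖ * ‖b‖ ≤ 1 := mul_le_one₀ (hab.trans hb) (norm_nonneg _) hb
    nlinarith
  refine ⟨?_, hb⟩
  by_contra ha
  push Not at ha
  have hr := norm_root_large hP hQ hPQ (norm_omega_pow ℓ hℓ (j - 1)) (isRoot_of_roots h).2 hb
  nlinarith

theorem roots_sPoly_one {ℓ : ℕ} {P Q : ℝ} (hP : 0 < P) (hPQ : P + Q = 1) (hlt : P < Q)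
    {a b : ℂ} (h : (sPoly ℓ P Q 1).roots = {a, b}) (ha : ‖a‖ ≤ 1) :
    a = 1 ∧ b = ((Q : ℂ) / P) ^ 2 := by
  have hPc : (P : ℂ) ≠ 0 := by exact_mod_cast hP.ne'
  have hQc : (Q : ℂ) = 1 - P := by rw [eq_sub_iff_add_eq']; exact_mod_cast hPQ
  obtain ⟨r1, r2⟩ := roots_relations hP.ne' h
  have ea := (isRoot_of_roots h).1
  simp only [Nat.sub_self, pow_zero, one_mul] at ea r2
  -- For `ω^0 = 1` and `P + Q = 1` the quadratic has the roots `1` and `(Q / P)^2 > 1`.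
  have hfac : (a - 1) * ((P : ℂ) ^ 2 * a - Q ^ 2) = 0 := by
    rw [hQc] at ea ⊢
    linear_combination ea
  have ha1 : a = 1 := by
    rcases mul_eq_zero.1 hfac with h1 | h1
    · exact sub_eq_zero.1 h1
    · exfalso
      have h2 := congrArg norm (sub_eq_zero.1 h1)
      simp only [norm_mul, norm_pow, Complex.norm_real, Real.norm_eq_abs, sq_abs] at h2
      have : P ^ 2 < Q ^ 2 := by gcongr
      nlinarith [sq_nonneg P]
  refine ⟨ha1, ?_⟩
  rw [ha1, one_mul] at r1
  rw [div_pow, eq_div_iff (pow_ne_zero 2 hPc), ← r1]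
  ring

/-! ### The row map, its ideal and the companion matrix -/

section

/-- The determinant of a polynomial in a matrix is the product of the values of the polynomial at
the eigenvalues. -/
theorem det_aeval_eq_prod {n : Type*} [Fintype n] [DecidableEq n] (A : Matrix n n ℂ) (f : ℂ[X]) :
    (aeval A f).det = (A.charpoly.roots.map fun r => f.eval r).prod := by
  have hlin : ∀ a : ℂ, (A - algebraMap ℂ _ a).det = (A.charpoly.roots.map fun r => r - a).prod := by
    intro a
    have h1 : (algebraMap ℂ _ a - A).det = (A.charpoly.roots.map fun r => a - r).prod := by
      have := (IsAlgClosed.splits A.charpoly).eval_eq_prod_roots_of_monic A.charpoly_monic a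
      rw [← this, Matrix.eval_charpoly]
      rfl
    have hcard : A.charpoly.roots.card = Fintype.card n := by
      rw [← (IsAlgClosed.splits A.charpoly).natDegree_eq_card_roots, A.charpoly_natDegree_eq_dim]
    have h2 : (A.charpoly.roots.map fun r => r - a)
        = A.charpoly.roots.map fun r => (-1) * (a - r) := by
      congr 1; funext r; ring
    rw [← neg_sub, Matrix.det_neg, h1, h2, Multiset.prod_map_mul, Multiset.map_const',
      Multiset.prod_replicate, hcard]
  have hprod : ∀ s : Multiset ℂ, (aeval A (s.map fun a => X - C a).prod).det
      = (A.charpoly.roots.map fun r => ((s.map fun a => X - C a).prod).eval r).prod := by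
    intro s
    induction s using Multiset.induction with
    | empty => simp
    | cons a s ih =>
      simp only [Multiset.map_cons, Multiset.prod_cons, map_mul, Matrix.det_mul, ih, eval_mul,
        Multiset.prod_map_mul, map_sub, aeval_X, aeval_C, hlin, eval_sub, eval_X, eval_C]
  have hf := (IsAlgClosed.splits f).eq_prod_roots
  have hcard : A.charpoly.roots.card = Fintype.card n := by
    rw [← (IsAlgClosed.splits A.charpoly).natDegree_eq_card_roots, A.charpoly_natDegree_eq_dim]
  rw [hf]
  simp only [map_mul, Matrix.det_mul, hprod, eval_mul, Multiset.prod_map_mul, aeval_C, eval_C,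
    Multiset.map_const', Multiset.prod_replicate, hcard]
  congr 1
  rw [Algebra.algebraMap_eq_smul_one, Matrix.det_smul, Matrix.det_one, mul_one]

/-- `det_aeval_eq_prod` for the polynomial `w - X ^ k` evaluates the characteristic polynomial of `A
^ k` at each `w`. -/
theorem roots_charpoly_pow {n : Type*} [Fintype n] [DecidableEq n] (A : Matrix n n ℂ) (k : ℕ) :
    (A ^ k).charpoly.roots = A.charpoly.roots.map (· ^ k) := by
  have : (A ^ k).charpoly = ((A.charpoly.roots.map (· ^ k)).map fun r => X - C r).prod := by
    refine Polynomial.funext fun w => ?_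
    have h := det_aeval_eq_prod A (C w - X ^ k)
    rw [Matrix.eval_charpoly, eval_multiset_prod, Multiset.map_map, Multiset.map_map]
    simp only [map_sub, aeval_C, map_pow, aeval_X, eval_sub, eval_C, eval_pow, eval_X] at h
    simpa [Function.comp_def, Matrix.algebraMap_eq_diagonal, Pi.algebraMap_def] using h
  rw [this, roots_multiset_prod_X_sub_C]

variable {ℓ : ℕ}

theorem linearMap_apply_eq {φ ψ : ℂ[X] →ₗ[ℂ] (Fin ℓ → ℂ)} (h : ∀ m : ℕ, φ (X ^ m) = ψ (X ^ m)) (f : ℂ[X]) :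
    φ f = ψ f := by
  have : φ = ψ := by
    refine (basisMonomials ℂ).ext fun m => ?_
    simpa only [coe_basisMonomials, monomial_one_right_eq_X_pow] using h m
  rw [this]

/-- The linear map `ℂ[X] → ℂ^ℓ` that sends `X ^ (k * ℓ + i)`, `i < ℓ`, to row `i` of `G ^ k`. -/
noncomputable def rowMap [NeZero ℓ] (G : Matrix (Fin ℓ) (Fin ℓ) ℂ) : ℂ[X] →ₗ[ℂ] (Fin ℓ → ℂ) :=
  (basisMonomials ℂ).constr ℂ fun m => (G ^ (m / ℓ)) ⟨m % ℓ, Nat.mod_lt _ (NeZero.pos ℓ)⟩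

variable [NeZero ℓ] (G : Matrix (Fin ℓ) (Fin ℓ) ℂ)

theorem rowMap_X_pow (k : ℕ) (i : Fin ℓ) : rowMap G (X ^ (ℓ * k + i)) = (G ^ k) i := by
  have h := (basisMonomials ℂ).constr_basis ℂ
    (fun m => (G ^ (m / ℓ)) ⟨m % ℓ, Nat.mod_lt _ (NeZero.pos ℓ)⟩) (ℓ * k + i)
  simp only [coe_basisMonomials, monomial_one_right_eq_X_pow] at h
  rw [rowMap, h]
  have h1 : (ℓ * k + i) / ℓ = k := by
    rw [Nat.mul_add_div (NeZero.pos ℓ), Nat.div_eq_of_lt i.2, add_zero]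
  have h2 : (ℓ * k + i) % ℓ = i := by
    rw [Nat.mul_add_mod, Nat.mod_eq_of_lt i.2]
  rw [h1]
  exact congrArg (G ^ k) (Fin.ext h2)

theorem rowMap_X_pow_lt (i : Fin ℓ) : rowMap G (X ^ (i : ℕ)) = Pi.single i 1 := by
  have := rowMap_X_pow G 0 i
  rw [mul_zero, zero_add, pow_zero] at this
  rw [this]
  funext j
  rw [Matrix.one_apply, Pi.single_apply]
  simp only [eq_comm]

theorem exists_eq_mul_add (m : ℕ) : ∃ k : ℕ, ∃ i : Fin ℓ, m = ℓ * k + i :=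
  ⟨m / ℓ, ⟨m % ℓ, Nat.mod_lt _ (NeZero.pos ℓ)⟩, (Nat.div_add_mod m ℓ).symm⟩

theorem rowMap_X_pow_mul (f : ℂ[X]) : rowMap G (X ^ ℓ * f) = Matrix.vecMul (rowMap G f) G := by
  refine linearMap_apply_eq (φ := rowMap G ∘ₗ LinearMap.mulLeft ℂ (X ^ ℓ))
    (ψ := G.vecMulLinear ∘ₗ rowMap G) (fun m => ?_) f
  obtain ⟨k, i, rfl⟩ := exists_eq_mul_add (ℓ := ℓ) m
  have : (X : ℂ[X]) ^ ℓ * X ^ (ℓ * k + i) = X ^ (ℓ * (k + 1) + i) := by ring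
  simp only [LinearMap.comp_apply, LinearMap.mulLeft_apply, this, rowMap_X_pow,
    Matrix.coe_vecMulLinear, pow_succ]
  rfl

theorem rowMap_expand_mul (g f : ℂ[X]) :
    rowMap G (expand ℂ ℓ g * f) = Matrix.vecMul (rowMap G f) (aeval G g) := by
  induction g using Polynomial.induction_on' with
  | add g₁ g₂ h₁ h₂ => simp only [map_add, add_mul, h₁, h₂, Matrix.vecMul_add]
  | monomial k a =>
    have key : ∀ k, rowMap G ((X ^ ℓ) ^ k * f) = Matrix.vecMul (rowMap G f) (G ^ k) := by
      intro k
      induction k with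
      | zero => simp
      | succ k ih => rw [pow_succ', mul_assoc, rowMap_X_pow_mul, ih, Matrix.vecMul_vecMul, pow_succ]
    rw [← C_mul_X_pow_eq_monomial, map_mul (expand ℂ ℓ), map_pow, expand_X, expand_C, mul_assoc, ← smul_eq_C_mul,
      map_smul, key, map_mul, map_pow, aeval_X, aeval_C, Algebra.algebraMap_eq_smul_one, smul_mul_assoc,
      one_mul, Matrix.vecMul_smul]

/-- The ideal of polynomials all of whose multiples are killed by `rowMap G`. -/
noncomputable def rowIdeal : Ideal ℂ[X] where
  carrier := {g | ∀ f, rowMap G (g * f) = 0}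
  add_mem' ha hb f := by rw [add_mul, map_add, ha, hb, add_zero]
  zero_mem' f := by rw [zero_mul, map_zero]
  smul_mem' c g hg f := by rw [smul_eq_mul, mul_comm c, mul_assoc]; exact hg _

theorem mem_rowIdeal {g : ℂ[X]} : g ∈ rowIdeal G ↔ ∀ f, rowMap G (g * f) = 0 := Iff.rfl

theorem expand_charpoly_mem_rowIdeal : expand ℂ ℓ G.charpoly ∈ rowIdeal G := by
  intro f
  rw [rowMap_expand_mul, Matrix.aeval_self_charpoly, Matrix.vecMul_zero]

variable {G}

/-- Below degree `ℓ` only `k = 0` occurs, and the rows of `G ^ 0` are the standard basis. So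
`rowMap` is injective there, whatever `G` is. -/
theorem rowMap_of_natDegree_lt {f : ℂ[X]} (hf : f.natDegree < ℓ) :
    rowMap G f = fun j : Fin ℓ => f.coeff j := by
  conv_lhs => rw [as_sum_range' f ℓ hf, ← Fin.sum_univ_eq_sum_range (fun i => monomial i (f.coeff i))]
  rw [map_sum]
  funext j
  rw [Finset.sum_apply, Finset.sum_eq_single j]
  · rw [← C_mul_X_pow_eq_monomial, ← smul_eq_C_mul, map_smul, rowMap_X_pow_lt]
    simp
  · intro b _ hb
    rw [← C_mul_X_pow_eq_monomial, ← smul_eq_C_mul, map_smul, rowMap_X_pow_lt]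
    simp [hb.symm]
  · simp

theorem rowMap_eq_coeff_modByMonic {S : ℂ[X]} (hS : S.Monic) (hdeg : S.natDegree = ℓ)
    (hmem : S ∈ rowIdeal G) (f : ℂ[X]) : rowMap G f = fun j : Fin ℓ => (f %ₘ S).coeff j := by
  conv_lhs => rw [← modByMonic_add_div f S, map_add, hmem, add_zero]
  refine rowMap_of_natDegree_lt ?_
  rw [← hdeg]
  refine natDegree_modByMonic_lt f hS fun h => ?_
  rw [h, natDegree_one] at hdeg
  exact NeZero.ne ℓ hdeg.symm

/-- Row `i` of `G` is the image of `X ^ (ℓ + i)`. The right side does not involve `G`: this is the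
source of uniqueness. -/
theorem apply_eq_coeff_modByMonic {S : ℂ[X]} (hS : S.Monic) (hdeg : S.natDegree = ℓ)
    (hmem : S ∈ rowIdeal G) (i j : Fin ℓ) : G i j = ((X ^ (ℓ + (i : ℕ))) %ₘ S).coeff j := by
  have h := rowMap_X_pow G 1 i
  rw [rowMap_eq_coeff_modByMonic hS hdeg hmem, mul_one, pow_one] at h
  exact (congrFun h j).symm

/-- Modulo `S`, multiplication by `X` itself becomes a matrix `c`, the companion matrix of `S`.
Comparing the two actions of `X ^ ℓ` gives `G = c ^ ℓ`. -/
theorem roots_charpoly_of_mem_rowIdeal {S : ℂ[X]} (hS : S.Monic) (hdeg : S.natDegree = ℓ)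
    (hmem : S ∈ rowIdeal G) : G.charpoly.roots = S.roots.map (· ^ ℓ) := by
  set c : Matrix (Fin ℓ) (Fin ℓ) ℂ := Matrix.of fun i => rowMap G (X ^ ((i : ℕ) + 1)) with hc
  have hX : ∀ f, rowMap G (X * f) = Matrix.vecMul (rowMap G f) c := by
    intro f
    have hlow : ∀ i : Fin ℓ, rowMap G (X * X ^ (i : ℕ)) = Matrix.vecMul (rowMap G (X ^ (i : ℕ))) c := by
      intro i
      rw [rowMap_X_pow_lt, Matrix.single_one_vecMul, ← pow_succ']
      rfl
    -- On the basis `X ^ i`, `i < ℓ`, the identity is the definition of `c`; the general case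
    -- follows by reducing `f` modulo `S`.
    have hmod : rowMap G (X * (f %ₘ S)) = Matrix.vecMul (rowMap G (f %ₘ S)) c := by
      have hlt : (f %ₘ S).natDegree < ℓ := by
        rw [← hdeg]
        refine natDegree_modByMonic_lt f hS fun h => ?_
        rw [h, natDegree_one] at hdeg
        exact NeZero.ne ℓ hdeg.symm
      rw [as_sum_range' (f %ₘ S) ℓ hlt,
        ← Fin.sum_univ_eq_sum_range (fun i => monomial i ((f %ₘ S).coeff i)), Finset.mul_sum, map_sum,
        map_sum, Matrix.sum_vecMul]
      refine Finset.sum_congr rfl fun i _ => ?_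
      rw [← C_mul_X_pow_eq_monomial, ← smul_eq_C_mul, map_smul, mul_smul_comm, map_smul, hlow,
        Matrix.smul_vecMul]
    have h1 : rowMap G (X * f) = rowMap G (X * (f %ₘ S)) := by
      conv_lhs => rw [← modByMonic_add_div f S, mul_add, map_add, mul_left_comm, hmem, add_zero]
    have h2 : rowMap G f = rowMap G (f %ₘ S) := by
      conv_lhs => rw [← modByMonic_add_div f S, map_add, hmem, add_zero]
    rw [h1, h2, hmod]
  have hg : ∀ g f, rowMap G (g * f) = Matrix.vecMul (rowMap G f) (aeval c g) := by
    intro g f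
    induction g using Polynomial.induction_on' with
    | add g₁ g₂ h₁ h₂ => simp only [map_add, add_mul, h₁, h₂, Matrix.vecMul_add]
    | monomial k a =>
      have key : ∀ k, rowMap G (X ^ k * f) = Matrix.vecMul (rowMap G f) (c ^ k) := by
        intro k
        induction k with
        | zero => simp
        | succ k ih => rw [pow_succ', mul_assoc, hX, ih, Matrix.vecMul_vecMul, pow_succ]
      rw [← C_mul_X_pow_eq_monomial, mul_assoc, ← smul_eq_C_mul,
        map_smul, key, map_mul, map_pow, aeval_X, aeval_C, Algebra.algebraMap_eq_smul_one,
        smul_mul_assoc, one_mul, Matrix.vecMul_smul]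
  have hpow : G = c ^ ℓ := by
    funext i
    have h1 := rowMap_X_pow_mul G (X ^ (i : ℕ))
    rw [hg (X ^ ℓ), rowMap_X_pow_lt, Matrix.single_one_vecMul, Matrix.single_one_vecMul, map_pow,
      aeval_X] at h1
    exact h1.symm
  have hSc : aeval c S = 0 := by
    funext i
    have h1 := hg S (X ^ (i : ℕ))
    rw [hmem, rowMap_X_pow_lt, Matrix.single_one_vecMul] at h1
    exact h1.symm
  have hchar : c.charpoly = S := by
    rw [← sub_eq_zero]
    by_contra hne
    -- Both polynomials annihilate `c`; their difference has degree below `ℓ`, where `rowMap` is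
    -- injective.
    have hzero : rowMap G (c.charpoly - S) = 0 := by
      have := hg (c.charpoly - S) 1
      rwa [mul_one, map_sub (aeval (R := ℂ) c), hSc, Matrix.aeval_self_charpoly, sub_zero, Matrix.vecMul_zero] at this
    have hcd : c.charpoly.natDegree = ℓ := by rw [c.charpoly_natDegree_eq_dim, Fintype.card_fin]
    have hlt : (c.charpoly - S).natDegree < ℓ := by
      have h1 : (c.charpoly - S).degree < c.charpoly.degree := by
        refine degree_sub_lt_left ?_ c.charpoly_monic.ne_zero ?_
        · rw [degree_eq_natDegree c.charpoly_monic.ne_zero, degree_eq_natDegree hS.ne_zero, hcd, hdeg]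
        · rw [c.charpoly_monic.leadingCoeff, hS.leadingCoeff]
      exact (natDegree_lt_natDegree hne h1).trans_eq hcd
    rw [rowMap_of_natDegree_lt hlt] at hzero
    apply hne
    ext m
    rcases lt_or_ge m ℓ with hm | hm
    · exact congrFun hzero ⟨m, hm⟩
    · rw [coeff_eq_zero_of_natDegree_lt (hlt.trans_le hm), coeff_zero]
  conv_lhs => rw [hpow]
  rw [roots_charpoly_pow, hchar]

end

/-! ### The matrix equation as membership of `h` in the ideal -/

section

variable {ℓ : ℕ}

/-- A complex solution of `A_{-1} + (A_0 - I) G + A_1 G^2 = 0`. -/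
def IsComplexSolution (ℓ : ℕ) (P Q : ℝ) (G : Matrix (Fin ℓ) (Fin ℓ) ℂ) : Prop :=
  (block ℓ P Q (-1)).map Complex.ofReal + ((block ℓ P Q 0).map Complex.ofReal - 1) * G
    + (block ℓ P Q 1).map Complex.ofReal * G ^ 2 = 0

theorem isComplexSolution_map {P Q : ℝ} {G : Matrix (Fin ℓ) (Fin ℓ) ℝ}
    (hG : block ℓ P Q (-1) + (block ℓ P Q 0 - 1) * G + block ℓ P Q 1 * G ^ 2 = 0) :
    IsComplexSolution ℓ P Q (G.map Complex.ofReal) := by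
  have := congrArg (RingHom.mapMatrix (m := Fin ℓ) Complex.ofRealHom) hG
  simp only [map_add, map_sub, map_mul, map_pow, map_one, map_zero] at this
  exact this

theorem coeff_X_pow_mul_linear_pow (P Q : ℝ) (i b : ℕ) :
    (X ^ i * (C (Q : ℂ) + C (P : ℂ) * X) ^ (2 * ℓ)).coeff b
      = (jumpProb ℓ P Q ((b : ℤ) - ℓ - i) : ℂ) := by
  rw [coeff_X_pow_mul']
  split_ifs with h
  · rw [jumpProb_eq_coeff ℓ P Q _ (b - i) (by omega)]
  · rw [jumpProb, if_neg (by omega), Complex.ofReal_zero]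

section

variable [NeZero ℓ] {P Q : ℝ} {G : Matrix (Fin ℓ) (Fin ℓ) ℂ}

/-- The degree is at most `i + 2ℓ < 3ℓ`, so the exponents split into three blocks `ℓ * k + j`, `k =
0, 1, 2`. The coefficient at `ℓ * k + j` is `(A_{k-1})_{ij}`, and block `k` contributes row `i` of
`A_{k-1} G ^ k`. -/
theorem rowMap_X_pow_mul_linear_pow (i : Fin ℓ) :
    rowMap G (X ^ (i : ℕ) * (C (Q : ℂ) + C (P : ℂ) * X) ^ (2 * ℓ))
      = ((block ℓ P Q (-1)).map Complex.ofReal + (block ℓ P Q 0).map Complex.ofReal * G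
        + (block ℓ P Q 1).map Complex.ofReal * G ^ 2) i := by
  have hdeg : (X ^ (i : ℕ) * (C (Q : ℂ) + C (P : ℂ) * X) ^ (2 * ℓ)).natDegree < ℓ + ℓ + ℓ := by
    refine natDegree_mul_le.trans_lt ?_
    have := natDegree_linear_pow_le ℓ P Q
    rw [natDegree_X_pow]
    have := i.2
    omega
  have hblock : ∀ (k : ℕ) (κ : ℤ), κ = (k : ℤ) - 1 →
      ∑ j ∈ Finset.range ℓ, rowMap G (monomial (ℓ * k + j)
        ((X ^ (i : ℕ) * (C (Q : ℂ) + C (P : ℂ) * X) ^ (2 * ℓ)).coeff (ℓ * k + j)))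
      = ((block ℓ P Q κ).map Complex.ofReal * G ^ k) i := by
    intro k κ hκ
    refine (Fin.sum_univ_eq_sum_range (fun j => rowMap G (monomial (ℓ * k + j)
        ((X ^ (i : ℕ) * (C (Q : ℂ) + C (P : ℂ) * X) ^ (2 * ℓ) : ℂ[X]).coeff (ℓ * k + j)))) ℓ).symm.trans ?_
    funext j'
    rw [Finset.sum_apply, Matrix.mul_apply]
    refine Finset.sum_congr rfl fun j _ => ?_
    rw [← C_mul_X_pow_eq_monomial, ← smul_eq_C_mul, map_smul, rowMap_X_pow,
      coeff_X_pow_mul_linear_pow, Pi.smul_apply, smul_eq_mul, Matrix.map_apply, block,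
      Matrix.of_apply, hκ]
    congr 4
    push_cast
    ring
  rw [as_sum_range' _ _ hdeg, map_sum, Finset.sum_range_add, Finset.sum_range_add]
  have h0 := hblock 0 (-1) (by norm_num)
  have h1 := hblock 1 0 (by norm_num)
  have h2 := hblock 2 1 (by norm_num)
  simp only [mul_zero, zero_add, mul_one, pow_zero, pow_one, mul_two] at h0 h1 h2
  rw [h0, h1, h2]
  rfl

/-- On `X ^ i` with `i < ℓ` this is row `i` of the matrix equation; a further factor `X ^ (ℓ * k)`
only multiplies the zero row by `G ^ k`. -/
theorem hPoly_mem_rowIdeal (hG : IsComplexSolution ℓ P Q G) : hPoly ℓ P Q ∈ rowIdeal G := by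
  intro f
  refine linearMap_apply_eq (φ := rowMap G ∘ₗ LinearMap.mulLeft ℂ (hPoly ℓ P Q)) (ψ := 0)
    (fun m => ?_) f
  obtain ⟨k, i, rfl⟩ := exists_eq_mul_add (ℓ := ℓ) m
  have hi : rowMap G (hPoly ℓ P Q * X ^ (i : ℕ)) = 0 := by
    have h1 : rowMap G (X ^ ℓ * X ^ (i : ℕ)) = G i := by
      have := rowMap_X_pow G 1 i
      rwa [mul_one, pow_one, pow_add] at this
    rw [mul_comm, hPoly_eq, mul_sub, map_sub, mul_comm _ (X ^ ℓ), h1, rowMap_X_pow_mul_linear_pow]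
    have := congrFun hG i
    rw [sub_mul, one_mul] at this
    funext j
    have := congrFun this j
    simp only [Matrix.add_apply, Matrix.sub_apply, Matrix.zero_apply, Pi.sub_apply,
      Pi.zero_apply] at this ⊢
    linear_combination -this
  have hk := rowMap_expand_mul G (X ^ k) (hPoly ℓ P Q * X ^ (i : ℕ))
  rw [hi, Matrix.zero_vecMul, map_pow, expand_X] at hk
  rw [LinearMap.comp_apply, LinearMap.mulLeft_apply, LinearMap.zero_apply, ← hk]
  congr 1
  ring

/-- The hypothesis on `M` makes it coprime to `χ_G(X ^ ℓ)`. Multiplying a Bézout relation by `S`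
writes `S` as a combination of `h` and `χ_G(X ^ ℓ)`, both in the ideal. -/
theorem factor_mem_rowIdeal {S M : ℂ[X]} (hG : IsComplexSolution ℓ P Q G)
    (hfac : hPoly ℓ P Q = S * M) (hM : ∀ z, M.IsRoot z → ¬ G.charpoly.IsRoot (z ^ ℓ)) :
    S ∈ rowIdeal G := by
  have hcop : IsCoprime M (expand ℂ ℓ G.charpoly) := by
    rw [isCoprime_iff_aeval_ne_zero_of_isAlgClosed (k := ℂ) ℂ]
    intro z
    by_contra! hz
    simp only [coe_aeval_eq_eval, expand_eval] at hz
    exact hM z hz.1 hz.2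
  obtain ⟨a, b, hab⟩ := hcop
  have : S = a * hPoly ℓ P Q + S * b * expand ℂ ℓ G.charpoly := by
    rw [hfac]
    linear_combination -S * hab
  rw [this]
  exact Ideal.add_mem _ (Ideal.mul_mem_left _ _ (hPoly_mem_rowIdeal hG))
    (Ideal.mul_mem_left _ _ (expand_charpoly_mem_rowIdeal G))

end

/-! ### Eigenvalue bounds and existence of a non-negative solution -/

theorem hasEigenvalue_iff_isRoot_charpoly (M : Matrix (Fin ℓ) (Fin ℓ) ℂ) (z : ℂ) :
    Module.End.HasEigenvalue (Matrix.toLin' M) z ↔ M.charpoly.IsRoot z := by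
  rw [Module.End.hasEigenvalue_iff_isRoot_charpoly, Matrix.charpoly_toLin']

theorem mem_eigenvalues_iff (M : Matrix (Fin ℓ) (Fin ℓ) ℝ) (z : ℂ) :
    z ∈ eigenvalues M ↔ z ∈ eigenvalueMultiset M := by
  rw [eigenvalueMultiset, mem_roots (Matrix.charpoly_monic _).ne_zero,
    ← hasEigenvalue_iff_isRoot_charpoly]
  rfl

/-- A non-negative matrix `G` with `G u ≤ τ u` for a positive vector `u` has all its eigenvalues in
the closed disk of radius `τ`. -/
theorem norm_eigenvalue_le {G : Matrix (Fin ℓ) (Fin ℓ) ℝ} (hG : ∀ i j, 0 ≤ G i j)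
    {u : Fin ℓ → ℝ} (hu : ∀ i, 0 < u i) {τ : ℝ} (h : ∀ i, ∑ j, G i j * u j ≤ τ * u i) {z : ℂ}
    (hz : z ∈ eigenvalues G) : ‖z‖ ≤ τ := by
  obtain ⟨v, hv⟩ := hz.exists_hasEigenvector
  have hne := hv.2
  have heq : ∀ i, ∑ j, (G i j : ℂ) * v j = z * v i := by
    intro i
    have := congrFun hv.apply_eq_smul i
    simpa [Matrix.toLin'_apply, Matrix.mulVec, dotProduct] using this
  obtain ⟨j₀, hj₀⟩ : ∃ j, v j ≠ 0 := by
    by_contra! hall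
    exact hne (funext hall)
  -- The index attains the maximum norm of the eigenvector weighted by `u`.
  obtain ⟨i, -, hi⟩ := Finset.exists_max_image Finset.univ (fun i => ‖v i‖ / u i) ⟨j₀, Finset.mem_univ _⟩
  have hm : 0 < ‖v i‖ / u i :=
    (div_pos (norm_pos_iff.2 hj₀) (hu j₀)).trans_le (hi j₀ (Finset.mem_univ _))
  set m := ‖v i‖ / u i with hmdef
  have hvj : ∀ j, ‖v j‖ ≤ m * u j := fun j => (div_le_iff₀ (hu j)).1 (hi j (Finset.mem_univ _))
  have hvi : ‖v i‖ = m * u i := by rw [hmdef, div_mul_cancel₀ _ (hu i).ne']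
  have hchain : ‖z‖ * (m * u i) ≤ τ * (m * u i) := by
    calc ‖z‖ * (m * u i) = ‖z * v i‖ := by rw [norm_mul, hvi]
      _ = ‖∑ j, (G i j : ℂ) * v j‖ := by rw [heq]
      _ ≤ ∑ j, ‖(G i j : ℂ) * v j‖ := norm_sum_le _ _
      _ ≤ ∑ j, G i j * (m * u j) := by
        refine Finset.sum_le_sum fun j _ => ?_
        rw [norm_mul, Complex.norm_of_nonneg (hG i j)]
        exact mul_le_mul_of_nonneg_left (hvj j) (hG i j)
      _ = m * ∑ j, G i j * u j := by
        rw [Finset.mul_sum]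
        exact Finset.sum_congr rfl fun j _ => by ring
      _ ≤ m * (τ * u i) := mul_le_mul_of_nonneg_left (h i) hm.le
      _ = τ * (m * u i) := by ring
  exact le_of_mul_le_mul_right hchain (mul_pos hm (hu i))

theorem jumpProb_nonneg {P Q : ℝ} (hP : 0 ≤ P) (hQ : 0 ≤ Q) (n : ℤ) : 0 ≤ jumpProb ℓ P Q n := by
  unfold jumpProb
  split_ifs <;> positivity

theorem block_nonneg {P Q : ℝ} (hP : 0 ≤ P) (hQ : 0 ≤ Q) (k : ℤ) (i j : Fin ℓ) :
    0 ≤ block ℓ P Q k i j := jumpProb_nonneg hP hQ _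

/-- If `(Q + P t) ^ 2 = t`, then the geometric vector `(t ^ i)` is harmonic for the walk. -/
theorem block_geometric {P Q t : ℝ} (ht : (Q + P * t) ^ 2 = t) (i : Fin ℓ) :
    ∑ j, block ℓ P Q (-1) i j * t ^ (j : ℕ) + t ^ ℓ * ∑ j, block ℓ P Q 0 i j * t ^ (j : ℕ)
      + t ^ (2 * ℓ) * ∑ j, block ℓ P Q 1 i j * t ^ (j : ℕ) = t ^ ℓ * t ^ (i : ℕ) := by
  have hdeg : (X ^ (i : ℕ) * (C (Q : ℂ) + C (P : ℂ) * X) ^ (2 * ℓ)).natDegree < ℓ + ℓ + ℓ := by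
    refine natDegree_mul_le.trans_lt ?_
    have := natDegree_linear_pow_le ℓ P Q
    rw [natDegree_X_pow]
    have := i.2
    omega
  -- The identity is the evaluation of `X ^ i * (Q + P X) ^ (2ℓ)` at `t`, with exponents cut into
  -- three blocks of length `ℓ`.
  have hev := eval_eq_sum_range' hdeg (t : ℂ)
  simp only [coeff_X_pow_mul_linear_pow] at hev
  have hl : eval (t : ℂ) (X ^ (i : ℕ) * (C (Q : ℂ) + C (P : ℂ) * X) ^ (2 * ℓ))
      = ((t ^ ℓ * t ^ (i : ℕ) : ℝ) : ℂ) := by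
    simp only [eval_mul, eval_pow, eval_X, eval_add, eval_C, pow_mul]
    rw [mul_comm]
    have : ((Q : ℂ) + P * t) ^ 2 = t := by exact_mod_cast ht
    rw [this]
    push_cast
    rfl
  rw [hl] at hev
  have hev' : t ^ ℓ * t ^ (i : ℕ)
      = ∑ b ∈ Finset.range (ℓ + ℓ + ℓ), jumpProb ℓ P Q ((b : ℤ) - ℓ - i) * t ^ b := by
    exact_mod_cast hev
  rw [hev', Finset.sum_range_add, Finset.sum_range_add]
  simp only [← Fin.sum_univ_eq_sum_range, Finset.mul_sum]
  congr 1
  · congr 1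
    · refine Finset.sum_congr rfl fun j _ => ?_
      rw [block, Matrix.of_apply]
      congr 2
      ring
    · refine Finset.sum_congr rfl fun j _ => ?_
      rw [block, Matrix.of_apply, pow_add, mul_left_comm]
      congr 3
      push_cast
      ring
  · refine Finset.sum_congr rfl fun j _ => ?_
    rw [block, Matrix.of_apply, pow_add, mul_left_comm, two_mul]
    congr 3
    push_cast
    ring

/-- The minimal non-negative solution, as limit of the monotone iteration
`G ↦ A_{-1} + A_0 G + A_1 G^2` started at `0`. -/
theorem exists_nonneg_solution {P Q t : ℝ} (hP : 0 ≤ P) (hQ : 0 ≤ Q) (ht0 : 0 < t)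
    (ht : (Q + P * t) ^ 2 = t) :
    ∃ G : Matrix (Fin ℓ) (Fin ℓ) ℝ, (∀ i j, 0 ≤ G i j) ∧
      (∀ i, ∑ j, G i j * t ^ (j : ℕ) ≤ t ^ ℓ * t ^ (i : ℕ)) ∧
      block ℓ P Q (-1) + (block ℓ P Q 0 - 1) * G + block ℓ P Q 1 * G ^ 2 = 0 := by
  let F : Matrix (Fin ℓ) (Fin ℓ) ℝ → Matrix (Fin ℓ) (Fin ℓ) ℝ :=
    fun G => block ℓ P Q (-1) + block ℓ P Q 0 * G + block ℓ P Q 1 * (G * G)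
  let g : ℕ → Matrix (Fin ℓ) (Fin ℓ) ℝ := fun n => F^[n] 0
  have hg0 : g 0 = 0 := rfl
  have hgs : ∀ n, g (n + 1) = F (g n) := fun n => Function.iterate_succ_apply' F n 0
  have mul_mono : ∀ {A B A' B' : Matrix (Fin ℓ) (Fin ℓ) ℝ}, (∀ i j, 0 ≤ A i j) →
      (∀ i j, 0 ≤ B i j) → (∀ i j, A i j ≤ A' i j) → (∀ i j, B i j ≤ B' i j) →
      ∀ i j, (A * B) i j ≤ (A' * B') i j := by
    intro A B A' B' hA hB hAA hBB i j
    simp only [Matrix.mul_apply]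
    exact Finset.sum_le_sum fun k _ =>
      mul_le_mul (hAA i k) (hBB k j) (hB k j) ((hA i k).trans (hAA i k))
  have mul_nn : ∀ {A B : Matrix (Fin ℓ) (Fin ℓ) ℝ}, (∀ i j, 0 ≤ A i j) →
      (∀ i j, 0 ≤ B i j) → ∀ i j, 0 ≤ (A * B) i j := by
    intro A B hA hB i j
    rw [Matrix.mul_apply]
    exact Finset.sum_nonneg fun k _ => mul_nonneg (hA i k) (hB k j)
  have b_nn : ∀ k i j, 0 ≤ block ℓ P Q k i j := fun k i j => block_nonneg hP hQ k i j
  have F_nn : ∀ {A : Matrix (Fin ℓ) (Fin ℓ) ℝ}, (∀ i j, 0 ≤ A i j) → ∀ i j, 0 ≤ F A i j :=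
    fun hA i j => add_nonneg (add_nonneg (b_nn _ i j) (mul_nn (b_nn _) hA i j))
      (mul_nn (b_nn _) (mul_nn hA hA) i j)
  have F_mono : ∀ {A B : Matrix (Fin ℓ) (Fin ℓ) ℝ}, (∀ i j, 0 ≤ A i j) →
      (∀ i j, A i j ≤ B i j) → ∀ i j, F A i j ≤ F B i j :=
    fun hA hAB i j => add_le_add (add_le_add le_rfl
        (mul_mono (b_nn _) hA (fun _ _ => le_rfl) hAB i j))
      (mul_mono (b_nn _) (mul_nn hA hA) (fun _ _ => le_rfl) (mul_mono hA hA hAB hAB) i j)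
  have g_nn : ∀ n i j, 0 ≤ g n i j := by
    intro n
    induction n with
    | zero => intro i j; rw [hg0]; exact le_rfl
    | succ n ih => rw [hgs]; exact F_nn ih
  have g_step : ∀ n i j, g n i j ≤ g (n + 1) i j := by
    intro n
    induction n with
    | zero => intro i j; rw [hg0]; exact g_nn 1 i j
    | succ n ih =>
      intro i j
      rw [hgs n, hgs (n + 1)]
      exact F_mono (g_nn n) ih i j
  have g_mono : ∀ i j, Monotone fun n => g n i j := fun i j => monotone_nat_of_le_succ fun n =>
    g_step n i j
  let u : Fin ℓ → ℝ := fun i => t ^ (i : ℕ)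
  have hu : ∀ i, 0 < u i := fun i => pow_pos ht0 _
  have mv : ∀ {A : Matrix (Fin ℓ) (Fin ℓ) ℝ} {v w : Fin ℓ → ℝ}, (∀ i j, 0 ≤ A i j) →
      (∀ i, v i ≤ w i) → ∀ i, (A.mulVec v) i ≤ (A.mulVec w) i := by
    intro A v w hA hvw i
    simp only [Matrix.mulVec, dotProduct]
    exact Finset.sum_le_sum fun j _ => mul_le_mul_of_nonneg_left (hvw j) (hA i j)
  -- The invariant `g n u ≤ t ^ ℓ u` passes through `F` because `block_geometric` makes it an
  -- equality for the bound. As `u` is positive, it bounds every entry of the iterates.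
  have g_sub : ∀ n i, ((g n).mulVec u) i ≤ t ^ ℓ * u i := by
    intro n
    induction n with
    | zero =>
      intro i
      rw [hg0, Matrix.zero_mulVec]
      exact mul_nonneg (pow_nonneg ht0.le _) (hu i).le
    | succ n ih =>
      intro i
      have ih' : ∀ i, ((g n).mulVec u) i ≤ (t ^ ℓ • u) i := ih
      have h1 := mv (b_nn 0) ih' i
      have h2 : ∀ i, ((g n).mulVec ((g n).mulVec u)) i ≤ (t ^ (2 * ℓ) • u) i := by
        intro i
        refine (mv (g_nn n) ih' i).trans ?_
        rw [Matrix.mulVec_smul, Pi.smul_apply, smul_eq_mul, Pi.smul_apply, smul_eq_mul, two_mul,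
          pow_add, mul_assoc]
        exact mul_le_mul_of_nonneg_left (ih i) (pow_nonneg ht0.le _)
      have h3 := mv (b_nn 1) h2 i
      rw [Matrix.mulVec_smul, Pi.smul_apply, smul_eq_mul] at h1 h3
      have h4 : (block ℓ P Q (-1)).mulVec u i + t ^ ℓ * (block ℓ P Q 0).mulVec u i
        + t ^ (2 * ℓ) * (block ℓ P Q 1).mulVec u i = t ^ ℓ * u i := block_geometric ht i
      have h5 : (g (n + 1)).mulVec u i = (block ℓ P Q (-1)).mulVec u i
          + (block ℓ P Q 0).mulVec ((g n).mulVec u) i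
          + (block ℓ P Q 1).mulVec ((g n).mulVec ((g n).mulVec u)) i := by
        rw [hgs]
        simp only [F, Matrix.add_mulVec, ← Matrix.mulVec_mulVec, Pi.add_apply]
      rw [h5]
      linarith
  have g_bdd : ∀ i j, BddAbove (Set.range fun n => g n i j) := by
    intro i j
    refine ⟨t ^ ℓ * u i / u j, ?_⟩
    rintro _ ⟨n, rfl⟩
    rw [le_div_iff₀ (hu j)]
    refine le_trans ?_ (g_sub n i)
    exact Finset.single_le_sum (f := fun j => g n i j * u j)
      (fun k _ => mul_nonneg (g_nn n i k) (hu k).le) (Finset.mem_univ j)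
  let G : Matrix (Fin ℓ) (Fin ℓ) ℝ := Matrix.of fun i j => ⨆ n, g n i j
  have hlim : Filter.Tendsto g Filter.atTop (nhds G) := by
    refine tendsto_pi_nhds.2 fun i => tendsto_pi_nhds.2 fun j => ?_
    exact tendsto_atTop_ciSup (g_mono i j) (g_bdd i j)
  have hFc : Continuous F := by
    fun_prop
  have hfix : F G = G := by
    have h1 : Filter.Tendsto (fun n => F (g n)) Filter.atTop (nhds (F G)) :=
      (hFc.tendsto G).comp hlim
    have h2 : Filter.Tendsto (fun n => g (n + 1)) Filter.atTop (nhds G) :=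
      hlim.comp (Filter.tendsto_add_atTop_nat 1)
    simp only [hgs] at h2
    exact tendsto_nhds_unique h1 h2
  refine ⟨G, fun i j => ?_, fun i => ?_, ?_⟩
  · exact (g_nn 0 i j).trans (le_ciSup (g_bdd i j) 0)
  · have hc : Continuous fun A : Matrix (Fin ℓ) (Fin ℓ) ℝ => A.mulVec u i := by
      have : Continuous fun A : Matrix (Fin ℓ) (Fin ℓ) ℝ => A.mulVec u := by fun_prop
      exact (continuous_apply i).comp this
    exact le_of_tendsto ((hc.tendsto G).comp hlim) (Filter.Eventually.of_forall fun n => g_sub n i)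
  · have : block ℓ P Q (-1) + (block ℓ P Q 0 - 1) * G + block ℓ P Q 1 * G ^ 2 = F G - G := by
      simp only [F, sub_mul, one_mul, pow_two]
      abel
    rw [this, hfix, sub_self]

end

/-! ### Solutions whose spectrum avoids the powers `b j ^ ℓ` -/

section Spectrum

variable {ℓ : ℕ} [NeZero ℓ] {P Q : ℝ} {a b : ℕ → ℂ}

/-- The monic polynomial with roots `a 1, …, a ℓ`. -/
noncomputable def rootPoly (ℓ : ℕ) (a : ℕ → ℂ) : ℂ[X] := ∏ j ∈ Finset.Icc 1 ℓ, (X - C (a j))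

theorem rootPoly_monic (ℓ : ℕ) (a : ℕ → ℂ) : (rootPoly ℓ a).Monic :=
  monic_prod_of_monic _ _ fun j _ => monic_X_sub_C (a j)

theorem natDegree_rootPoly (ℓ : ℕ) (a : ℕ → ℂ) : (rootPoly ℓ a).natDegree = ℓ := by
  rw [rootPoly, natDegree_prod_of_monic _ _ fun j _ => monic_X_sub_C (a j)]
  simp

theorem roots_rootPoly (ℓ : ℕ) (a : ℕ → ℂ) :
    (rootPoly ℓ a).roots = (Finset.Icc 1 ℓ).val.map a := by
  have : rootPoly ℓ a = (((Finset.Icc 1 ℓ).val.map a).map fun r => X - C r).prod := by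
    rw [Multiset.map_map]
    rfl
  rw [this, roots_multiset_prod_X_sub_C]

theorem rootPoly_mem_rowIdeal (hP : P ≠ 0)
    (hroots : ∀ j ∈ Finset.Icc 1 ℓ, (sPoly ℓ P Q j).roots = {a j, b j})
    {G : Matrix (Fin ℓ) (Fin ℓ) ℝ}
    (hG : block ℓ P Q (-1) + (block ℓ P Q 0 - 1) * G + block ℓ P Q 1 * G ^ 2 = 0)
    (hb : ∀ j ∈ Finset.Icc 1 ℓ, b j ^ ℓ ∉ eigenvalues G) :
    rootPoly ℓ a ∈ rowIdeal (G.map Complex.ofReal) := by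
  -- The sign and the leading coefficients `P ^ 2` go into the cofactor, so that `rootPoly` stays
  -- monic.
  refine factor_mem_rowIdeal (M := -∏ j ∈ Finset.Icc 1 ℓ, C ((P : ℂ) ^ 2) * (X - C (b j)))
    (isComplexSolution_map hG) ?_ ?_
  · rw [hPoly_eq_neg_prod ℓ (NeZero.pos ℓ), rootPoly, mul_neg, ← Finset.prod_mul_distrib]
    congr 1
    refine Finset.prod_congr rfl fun j hj => ?_
    rw [sPoly_eq_of_roots hP (hroots j hj)]
    ring
  · intro z hz hz'
    rw [IsRoot.def, eval_neg, neg_eq_zero, eval_prod, Finset.prod_eq_zero_iff] at hz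
    obtain ⟨j, hj, hzj⟩ := hz
    have hP' : (P : ℂ) ≠ 0 := by exact_mod_cast hP
    simp only [eval_mul, eval_C, eval_sub, eval_X, mul_eq_zero, pow_eq_zero_iff, ne_eq,
      OfNat.ofNat_ne_zero, not_false_eq_true, hP', false_or, sub_eq_zero] at hzj
    rw [hzj] at hz'
    exact hb j hj ((hasEigenvalue_iff_isRoot_charpoly _ _).2 hz')

theorem solution_unique (hP : P ≠ 0)
    (hroots : ∀ j ∈ Finset.Icc 1 ℓ, (sPoly ℓ P Q j).roots = {a j, b j})
    {G G' : Matrix (Fin ℓ) (Fin ℓ) ℝ}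
    (hG : block ℓ P Q (-1) + (block ℓ P Q 0 - 1) * G + block ℓ P Q 1 * G ^ 2 = 0)
    (hb : ∀ j ∈ Finset.Icc 1 ℓ, b j ^ ℓ ∉ eigenvalues G)
    (hG' : block ℓ P Q (-1) + (block ℓ P Q 0 - 1) * G' + block ℓ P Q 1 * G' ^ 2 = 0)
    (hb' : ∀ j ∈ Finset.Icc 1 ℓ, b j ^ ℓ ∉ eigenvalues G') : G = G' := by
  ext i j
  have h := apply_eq_coeff_modByMonic (rootPoly_monic ℓ a) (natDegree_rootPoly ℓ a)
    (rootPoly_mem_rowIdeal hP hroots hG hb) i j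
  have h' := apply_eq_coeff_modByMonic (rootPoly_monic ℓ a) (natDegree_rootPoly ℓ a)
    (rootPoly_mem_rowIdeal hP hroots hG' hb') i j
  exact Complex.ofReal_injective (h.trans h'.symm)

theorem eigenvalueMultiset_solution (hP : P ≠ 0)
    (hroots : ∀ j ∈ Finset.Icc 1 ℓ, (sPoly ℓ P Q j).roots = {a j, b j})
    {G : Matrix (Fin ℓ) (Fin ℓ) ℝ}
    (hG : block ℓ P Q (-1) + (block ℓ P Q 0 - 1) * G + block ℓ P Q 1 * G ^ 2 = 0)
    (hb : ∀ j ∈ Finset.Icc 1 ℓ, b j ^ ℓ ∉ eigenvalues G) :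
    eigenvalueMultiset G = (Finset.Icc 1 ℓ).val.map fun j => a j ^ ℓ := by
  rw [eigenvalueMultiset, roots_charpoly_of_mem_rowIdeal (rootPoly_monic ℓ a)
    (natDegree_rootPoly ℓ a) (rootPoly_mem_rowIdeal hP hroots hG hb), roots_rootPoly,
    Multiset.map_map]
  rfl

/-- Row `i` lists the coefficients of `X ^ (ℓ + i)` modulo `rootPoly ℓ a`. As `1` is a root of the
divisor, the remainder takes the value `1` there. -/
theorem sum_row_solution (hP : P ≠ 0)
    (hroots : ∀ j ∈ Finset.Icc 1 ℓ, (sPoly ℓ P Q j).roots = {a j, b j}) (ha : a 1 = 1)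
    {G : Matrix (Fin ℓ) (Fin ℓ) ℝ}
    (hG : block ℓ P Q (-1) + (block ℓ P Q 0 - 1) * G + block ℓ P Q 1 * G ^ 2 = 0)
    (hb : ∀ j ∈ Finset.Icc 1 ℓ, b j ^ ℓ ∉ eigenvalues G) (i : Fin ℓ) : ∑ j, G i j = 1 := by
  have hℓ : 1 ≤ ℓ := NeZero.pos ℓ
  have hdeg := natDegree_rootPoly ℓ a
  have hlt : ((X : ℂ[X]) ^ (ℓ + (i : ℕ)) %ₘ rootPoly ℓ a).natDegree < ℓ := by
    refine (natDegree_modByMonic_lt _ (rootPoly_monic ℓ a) fun h => ?_).trans_eq hdeg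
    rw [h, natDegree_one] at hdeg
    exact NeZero.ne ℓ hdeg.symm
  have hroot : eval 1 (rootPoly ℓ a) = 0 := by
    rw [rootPoly, eval_prod]
    exact Finset.prod_eq_zero (Finset.mem_Icc.2 ⟨le_rfl, hℓ⟩) (by simp [ha])
  have hev : eval 1 ((X : ℂ[X]) ^ (ℓ + (i : ℕ)) %ₘ rootPoly ℓ a) = 1 := by
    have := congrArg (eval 1) (modByMonic_add_div ((X : ℂ[X]) ^ (ℓ + (i : ℕ))) (rootPoly ℓ a))
    simpa [hroot] using this
  rw [eval_eq_sum_range' hlt, ← Fin.sum_univ_eq_sum_range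
    (fun j => (X ^ (ℓ + (i : ℕ)) %ₘ rootPoly ℓ a).coeff j * (1 : ℂ) ^ j)] at hev
  have hsum : ∑ j, (G i j : ℂ) = 1 := by
    rw [← hev]
    refine Finset.sum_congr rfl fun j _ => ?_
    rw [one_pow, mul_one]
    exact apply_eq_coeff_modByMonic (rootPoly_monic ℓ a) (natDegree_rootPoly ℓ a)
      (rootPoly_mem_rowIdeal hP hroots hG hb) i j
  exact_mod_cast hsum

end Spectrum

/-! ### Transposition exchanges `P` and `Q` -/

section Duality

variable {ℓ : ℕ} {P Q : ℝ}

theorem jumpProb_swap (ℓ : ℕ) (P Q : ℝ) (n : ℤ) : jumpProb ℓ Q P (-n) = jumpProb ℓ P Q n := by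
  unfold jumpProb
  by_cases h : -(ℓ : ℤ) ≤ n ∧ n ≤ ℓ
  · rw [if_pos h, if_pos (by omega)]
    have h1 : ((ℓ : ℤ) + -n).toNat = ((ℓ : ℤ) - n).toNat := by omega
    have h2 : ((ℓ : ℤ) - -n).toNat = ((ℓ : ℤ) + n).toNat := by omega
    rw [h1, h2, Nat.choose_symm_of_eq_add (b := ((ℓ : ℤ) + n).toNat) (by omega)]
    ring
  · rw [if_neg h, if_neg (by omega)]

theorem block_transpose (ℓ : ℕ) (P Q : ℝ) (k : ℤ) :
    (block ℓ P Q k).transpose = block ℓ Q P (-k) := by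
  ext i j
  rw [Matrix.transpose_apply, block, block, Matrix.of_apply, Matrix.of_apply, ← jumpProb_swap]
  congr 1
  ring

theorem transpose_equation {R : Matrix (Fin ℓ) (Fin ℓ) ℝ} :
    R ^ 2 * block ℓ P Q (-1) + R * (block ℓ P Q 0 - 1) + block ℓ P Q 1 = 0 ↔
      block ℓ Q P (-1) + (block ℓ Q P 0 - 1) * R.transpose
        + block ℓ Q P 1 * R.transpose ^ 2 = 0 := by
  rw [← Matrix.transpose_eq_zero]
  simp only [Matrix.transpose_add, Matrix.transpose_mul, Matrix.transpose_sub,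
    Matrix.transpose_one, Matrix.transpose_pow, block_transpose, neg_neg, neg_zero]
  rw [add_comm, ← add_assoc, add_right_comm]

theorem eigenvalueMultiset_transpose (M : Matrix (Fin ℓ) (Fin ℓ) ℝ) :
    eigenvalueMultiset M.transpose = eigenvalueMultiset M := by
  rw [eigenvalueMultiset, Matrix.transpose_map, Matrix.charpoly_transpose, eigenvalueMultiset]

theorem eigenvalues_transpose (M : Matrix (Fin ℓ) (Fin ℓ) ℝ) :
    eigenvalues M.transpose = eigenvalues M := by
  ext z
  rw [mem_eigenvalues_iff, eigenvalueMultiset_transpose, mem_eigenvalues_iff]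

/-- Exchanging `P` and `Q` reverses the coefficients of the quadratic, so its roots become their
inverses. -/
theorem roots_sPoly_swap (hP : P ≠ 0) (hQ : Q ≠ 0) {j : ℕ} {a b : ℂ}
    (h : (sPoly ℓ P Q j).roots = {a, b}) : (sPoly ℓ Q P j).roots = {b⁻¹, a⁻¹} := by
  obtain ⟨r1, r2⟩ := roots_relations hP h
  have hPc : (P : ℂ) ≠ 0 := by exact_mod_cast hP
  have hQc : (Q : ℂ) ^ 2 ≠ 0 := pow_ne_zero 2 (by exact_mod_cast hQ)
  have hab : a * b ≠ 0 := fun h0 => hQc (by rw [← r1, h0, mul_zero])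
  have ha : a ≠ 0 := left_ne_zero_of_mul hab
  have hb : b ≠ 0 := right_ne_zero_of_mul hab
  have c0 : (P : ℂ) ^ 2 = (Q : ℂ) ^ 2 * (b⁻¹ * a⁻¹) := by
    rw [← r1]
    field_simp
  have c1 : 2 * (Q : ℂ) * P - omega ℓ ^ (j - 1) = -((Q : ℂ) ^ 2 * (b⁻¹ + a⁻¹)) := by
    have : (Q : ℂ) ^ 2 * (b⁻¹ + a⁻¹) = (P : ℂ) ^ 2 * (a + b) := by
      rw [← r1]
      field_simp
    rw [this, r2]
    ring
  have hs : sPoly ℓ Q P j = C ((Q : ℂ) ^ 2) * (({b⁻¹, a⁻¹} : Multiset ℂ).map fun r => X - C r).prod := by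
    rw [sPoly_eq, c0, c1]
    simp only [Multiset.insert_eq_cons, Multiset.map_cons, Multiset.map_singleton,
      Multiset.prod_cons, Multiset.prod_singleton, C_mul, C_neg, C_add]
    ring
  rw [hs, roots_C_mul _ hQc, roots_multiset_prod_X_sub_C]

end Duality

/-! ### Separation of the spectra, and existence of `R` and `G` -/

section Labelled

variable {ℓ : ℕ} {P Q : ℝ} {σ μ : ℕ → ℂ}

theorem eigenvalues_eq_of_multiset {M : Matrix (Fin ℓ) (Fin ℓ) ℝ} {f : ℕ → ℂ}
    (h : eigenvalueMultiset M = (Finset.Icc 1 ℓ).val.map f) :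
    eigenvalues M = {z | ∃ j ∈ Finset.Icc 1 ℓ, z = f j} := by
  ext z
  rw [mem_eigenvalues_iff, h, Multiset.mem_map]
  simp only [Finset.mem_val, Set.mem_ofPred_eq, eq_comm]

theorem IsG.norm_eigenvalue_le_one {G : Matrix (Fin ℓ) (Fin ℓ) ℝ} (hG : IsG ℓ P Q G) {z : ℂ}
    (hz : z ∈ eigenvalues G) : ‖z‖ ≤ 1 := by
  refine norm_eigenvalue_le (u := fun _ => 1)
    (fun i j => Matrix.nonneg_of_mem_rowStochastic hG.stochastic) (fun _ => one_pos) (fun i => ?_) hz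
  simp [Matrix.sum_row_of_mem_rowStochastic hG.stochastic i]

theorem IsR.transpose_equation {R : Matrix (Fin ℓ) (Fin ℓ) ℝ} (hR : IsR ℓ P Q R) :
    block ℓ Q P (-1) + (block ℓ Q P 0 - 1) * R.transpose
      + block ℓ Q P 1 * R.transpose ^ 2 = 0 :=
  TrafficQBD.transpose_equation.1 hR.equation

theorem pow_notMem_eigenvalues (hℓ : ℓ ≠ 0) (hμ : ∀ j ∈ Finset.Icc 1 ℓ, 1 < ‖μ j‖)
    {G : Matrix (Fin ℓ) (Fin ℓ) ℝ} (hG : ∀ z ∈ eigenvalues G, ‖z‖ ≤ 1) :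
    ∀ j ∈ Finset.Icc 1 ℓ, μ j ^ ℓ ∉ eigenvalues G := by
  intro j hj hmem
  have h1 := hG _ hmem
  rw [norm_pow] at h1
  exact absurd h1 (not_le.2 (one_lt_pow₀ (hμ j hj) hℓ))

/-- Here the strict inequality sits on the eigenvalues of `R`, because `‖σ j‖ = 1` is allowed. -/
theorem inv_pow_notMem_eigenvalues (hσ0 : ∀ j ∈ Finset.Icc 1 ℓ, σ j ≠ 0)
    (hσ : ∀ j ∈ Finset.Icc 1 ℓ, ‖σ j‖ ≤ 1)
    {R : Matrix (Fin ℓ) (Fin ℓ) ℝ} (hR : ∀ z ∈ eigenvalues R, ‖z‖ < 1) :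
    ∀ j ∈ Finset.Icc 1 ℓ, (σ j)⁻¹ ^ ℓ ∉ eigenvalues R.transpose := by
  intro j hj hmem
  rw [eigenvalues_transpose] at hmem
  have h1 := hR _ hmem
  rw [norm_pow, norm_inv] at h1
  exact absurd h1 (not_lt.2 (one_le_pow₀
    ((one_le_inv₀ (norm_pos_iff.2 (hσ0 j hj))).2 (hσ j hj))))

theorem small_root_ne_zero {j : ℕ} {a b : ℂ} (hP : P ≠ 0) (hQ : Q ≠ 0)
    (h : (sPoly ℓ P Q j).roots = {a, b}) : a ≠ 0 := by
  intro ha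
  have := (roots_relations hP h).1
  rw [ha, zero_mul, mul_zero] at this
  exact pow_ne_zero 2 (by exact_mod_cast hQ : (Q : ℂ) ≠ 0) this.symm

/-- For the exchanged walk `t = (P / Q)^2 < 1` solves `(P + Q t)^2 = t`. The geometric vector then
bounds all eigenvalues by `t ^ ℓ < 1`. -/
theorem exists_isR (hℓ : ℓ ≠ 0) (hP : 0 < P) (hPQ : P + Q = 1) (hlt : P < Q) :
    ∃ R, IsR ℓ P Q R := by
  have hQ : 0 < Q := hP.trans hlt
  have ht0 : 0 < (P / Q) ^ 2 := by positivity
  have ht1 : (P / Q) ^ 2 < 1 := pow_lt_one₀ (by positivity) ((div_lt_one hQ).2 hlt) two_ne_zero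
  have ht : (P + Q * (P / Q) ^ 2) ^ 2 = (P / Q) ^ 2 := by
    have : P + Q * (P / Q) ^ 2 = P * (P + Q) / Q := by
      field_simp
      ring
    rw [this, hPQ, mul_one]
  obtain ⟨H, hnn, hsub, heq⟩ := exists_nonneg_solution (ℓ := ℓ) hQ.le hP.le ht0 ht
  refine ⟨H.transpose, fun i j => hnn j i, fun z hz => ?_, ?_⟩
  · rw [eigenvalues_transpose] at hz
    exact (norm_eigenvalue_le hnn (fun i => pow_pos ht0 _) hsub hz).trans_lt
      (pow_lt_one₀ ht0.le ht1 hℓ)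
  · rw [TrafficQBD.transpose_equation, Matrix.transpose_transpose]
    exact heq

/-- With `t = 1` the iteration only gives row sums at most `1`. This already keeps the spectrum away
from the `μ j ^ ℓ`, and `sum_row_solution` then gives equality. -/
theorem exists_isG [NeZero ℓ] (hP : 0 < P) (hQ : 0 < Q) (hPQ : P + Q = 1)
    (hroots : ∀ j ∈ Finset.Icc 1 ℓ, (sPoly ℓ P Q j).roots = {σ j, μ j}) (hσ : σ 1 = 1)
    (hμ : ∀ j ∈ Finset.Icc 1 ℓ, 1 < ‖μ j‖) : ∃ G, IsG ℓ P Q G := by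
  obtain ⟨G, hnn, hsub, heq⟩ := exists_nonneg_solution (ℓ := ℓ) (P := P) (Q := Q) (t := 1) hP.le
    hQ.le one_pos (by rw [mul_one, add_comm, hPQ, one_pow])
  have hle : ∀ z ∈ eigenvalues G, ‖z‖ ≤ 1 := fun z hz => by
    have := norm_eigenvalue_le hnn (fun i => pow_pos one_pos _) hsub hz
    rwa [one_pow] at this
  refine ⟨G, Matrix.mem_rowStochastic_iff_sum.2 ⟨hnn, ?_⟩, heq⟩
  exact sum_row_solution hP.ne' hroots hσ heq (pow_notMem_eigenvalues (NeZero.ne ℓ) hμ hle)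

end Labelled

end TrafficQBD

theorem lemma3 (ℓ : ℕ) (hℓ : 1 ≤ ℓ) (p q : ℝ) (hp : 0 < p) (hq : q = 1 - p) (hpq : p < q) :
    -- the polynomial `h`, and its roots (as a set, and with multiplicity)
    (TrafficQBD.hPoly ℓ p q =
        Polynomial.X ^ ℓ
          - (Polynomial.C (q : ℂ) + Polynomial.C (p : ℂ) * Polynomial.X) ^ (2 * ℓ)) ∧
    (∀ z : ℂ, (TrafficQBD.hPoly ℓ p q).IsRoot z ↔
        ∃ j ∈ Finset.Icc 1 ℓ, (TrafficQBD.sPoly ℓ p q j).IsRoot z) ∧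
    ((TrafficQBD.hPoly ℓ p q).roots =
        ∑ j ∈ Finset.Icc 1 ℓ, (TrafficQBD.sPoly ℓ p q j).roots) ∧
    -- the objects named below exist, and `G` and `R` are unique
    (∃ σ μ : ℕ → ℂ, TrafficQBD.IsRootLabelling ℓ p q σ μ) ∧
    (∃! G : Matrix (Fin ℓ) (Fin ℓ) ℝ, TrafficQBD.IsG ℓ p q G) ∧
    (∃! R : Matrix (Fin ℓ) (Fin ℓ) ℝ, TrafficQBD.IsR ℓ p q R) ∧
    (∀ σ μ : ℕ → ℂ, TrafficQBD.IsRootLabelling ℓ p q σ μ →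
      -- location of the roots
      (∀ j ∈ Finset.Icc 1 ℓ, ‖σ j‖ ≤ 1 ∧ 1 < ‖μ j‖) ∧
      σ 1 = 1 ∧ μ 1 = ((q : ℂ) / (p : ℂ)) ^ 2 ∧
      -- eigenvalues of `G` and of `R` (as sets, and with algebraic multiplicity)
      (∀ G : Matrix (Fin ℓ) (Fin ℓ) ℝ, TrafficQBD.IsG ℓ p q G →
        TrafficQBD.eigenvalues G = {z | ∃ j ∈ Finset.Icc 1 ℓ, z = σ j ^ ℓ} ∧
        TrafficQBD.eigenvalueMultiset G =
          (Finset.Icc 1 ℓ).val.map (fun j => σ j ^ ℓ)) ∧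
      (∀ R : Matrix (Fin ℓ) (Fin ℓ) ℝ, TrafficQBD.IsR ℓ p q R →
        TrafficQBD.eigenvalues R = {z | ∃ j ∈ Finset.Icc 1 ℓ, z = (μ j ^ ℓ)⁻¹} ∧
        TrafficQBD.eigenvalueMultiset R =
          (Finset.Icc 1 ℓ).val.map (fun j => (μ j ^ ℓ)⁻¹))) := by
  have hsum : p + q = 1 := by linarith
  have hq0 : 0 < q := hp.trans hpq
  have hne : ℓ ≠ 0 := by omega
  have : NeZero ℓ := ⟨hne⟩
  have hone : 1 ∈ Finset.Icc 1 ℓ := Finset.mem_Icc.2 ⟨le_rfl, hℓ⟩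
  have hloc : ∀ σ μ : ℕ → ℂ, TrafficQBD.IsRootLabelling ℓ p q σ μ →
      ∀ j ∈ Finset.Icc 1 ℓ, ‖σ j‖ ≤ 1 ∧ 1 < ‖μ j‖ := fun σ μ h j hj =>
    TrafficQBD.norm_roots hℓ hp hsum hpq (h j hj).1 (h j hj).2
  have hfirst : ∀ σ μ : ℕ → ℂ, TrafficQBD.IsRootLabelling ℓ p q σ μ →
      σ 1 = 1 ∧ μ 1 = ((q : ℂ) / (p : ℂ)) ^ 2 := fun σ μ h =>
    TrafficQBD.roots_sPoly_one hp hsum hpq (h 1 hone).1 (hloc σ μ h 1 hone).1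
  have hswap : ∀ σ μ : ℕ → ℂ, TrafficQBD.IsRootLabelling ℓ p q σ μ →
      ∀ j ∈ Finset.Icc 1 ℓ, (TrafficQBD.sPoly ℓ q p j).roots = {(μ j)⁻¹, (σ j)⁻¹} :=
    fun σ μ h j hj => TrafficQBD.roots_sPoly_swap hp.ne' hq0.ne' (h j hj).1
  have hsepG : ∀ σ μ : ℕ → ℂ, TrafficQBD.IsRootLabelling ℓ p q σ μ →
      ∀ G, TrafficQBD.IsG ℓ p q G →
        ∀ j ∈ Finset.Icc 1 ℓ, μ j ^ ℓ ∉ TrafficQBD.eigenvalues G := fun σ μ h G hG =>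
    TrafficQBD.pow_notMem_eigenvalues hne (fun j hj => (hloc σ μ h j hj).2)
      fun z hz => hG.norm_eigenvalue_le_one hz
  have hsepR : ∀ σ μ : ℕ → ℂ, TrafficQBD.IsRootLabelling ℓ p q σ μ →
      ∀ R, TrafficQBD.IsR ℓ p q R →
        ∀ j ∈ Finset.Icc 1 ℓ, (σ j)⁻¹ ^ ℓ ∉ TrafficQBD.eigenvalues R.transpose :=
    fun σ μ h R hR => TrafficQBD.inv_pow_notMem_eigenvalues
      (fun j hj => TrafficQBD.small_root_ne_zero hp.ne' hq0.ne' (h j hj).1)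
      (fun j hj => (hloc σ μ h j hj).1) hR.eigenvalues_lt
  obtain ⟨σ₀, μ₀, h₀⟩ := TrafficQBD.exists_isRootLabelling ℓ hp.ne' q
  refine ⟨TrafficQBD.hPoly_eq ℓ p q, TrafficQBD.isRoot_hPoly_iff ℓ hℓ p q,
    TrafficQBD.roots_hPoly ℓ hℓ hp.ne' q, ⟨σ₀, μ₀, h₀⟩, ?_, ?_, ?_⟩
  · obtain ⟨G, hG⟩ := TrafficQBD.exists_isG hp hq0 hsum (fun j hj => (h₀ j hj).1)
      (hfirst σ₀ μ₀ h₀).1 (fun j hj => (hloc σ₀ μ₀ h₀ j hj).2)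
    exact ⟨G, hG, fun G' hG' => TrafficQBD.solution_unique hp.ne' (fun j hj => (h₀ j hj).1)
      hG'.equation (hsepG σ₀ μ₀ h₀ G' hG') hG.equation (hsepG σ₀ μ₀ h₀ G hG)⟩
  · obtain ⟨R, hR⟩ := TrafficQBD.exists_isR hne hp hsum hpq
    exact ⟨R, hR, fun R' hR' => Matrix.transpose_injective
      (TrafficQBD.solution_unique (a := fun j => (μ₀ j)⁻¹) hq0.ne' (hswap σ₀ μ₀ h₀)
        hR'.transpose_equation (hsepR σ₀ μ₀ h₀ R' hR')
        hR.transpose_equation (hsepR σ₀ μ₀ h₀ R hR))⟩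
  · intro σ μ h
    refine ⟨hloc σ μ h, (hfirst σ μ h).1, (hfirst σ μ h).2, fun G hG => ?_, fun R hR => ?_⟩
    · have hm := TrafficQBD.eigenvalueMultiset_solution hp.ne' (fun j hj => (h j hj).1)
        hG.equation (hsepG σ μ h G hG)
      exact ⟨TrafficQBD.eigenvalues_eq_of_multiset hm, hm⟩
    · have hm := TrafficQBD.eigenvalueMultiset_solution (a := fun j => (μ j)⁻¹) hq0.ne'
        (hswap σ μ h) hR.transpose_equation (hsepR σ μ h R hR)
      simp only [TrafficQBD.eigenvalueMultiset_transpose, inv_pow] at hm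
      exact ⟨TrafficQBD.eigenvalues_eq_of_multiset hm, hm⟩
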